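/- \textbf{Theorem (measurability of the minimum expected robust Wasserstein estimator).} Let $(\mathcal X, d)$ be a metric space whose topology is Polish, with its Borel $\sigma$-algebra, and let $\lambda \ge 0$. For Borel probability measures $\mu,\nu$ on $\mathcal X$ put $$W^{(\lambda)}(\mu,\nu) := \inf_{\pi\in\Pi(\mu,\nu)} \int_{\mathcal X\times\mathcal X} \min\{d(x,y),2\lambda\}\, d\pi(x,y),$$ where $\Pi(\mu,\nu)$ is the set of Borel probability measures on $\mathcal X\times\mathcal X$ with marginals $\mu$ and $\nu$. Let $\Theta$ be a non-empty $\sigma$-compact Borel subset of $\mathbb R^{d_\theta}$, equipped with a metric $\rho_\Theta$ such that $\theta_k\to\theta$ in $\Theta$ for the usual topology implies $\rho_\Theta(\theta_k,\theta)\to 0$ (for instance the Euclidean metric, or any metric that induces the usual topology). For every $m\ge 1$ let $(\mu^{(m)}_\theta)_{\theta\in\Theta}$ be a family of Borel probability measures on $\mathcal X^m$, and assume that for every $m\ge1$: if $\rho_\Theta(\theta_k,\theta)\to0$ as $k\to\infty$, then $\mu^{(m)}_{\theta_k}$ converges weakly to $\mu^{(m)}_{\theta}$. Let $n\ge 1$,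 let $X_1,\dots,X_n$ be $\mathcal X$-valued measurable maps on a measurable space $\Omega$, and let $\hat\mu_n(\omega)=n^{-1}\sum_{i=1}^n\delta_{X_i(\omega)}$. For $m\ge1$ set $$F_{n,m}(\omega,\theta) := \mathrm E_m\big[W^{(\lambda)}(\hat\mu_n(\omega),\hat\mu_{\theta,m})\big] = \int_{\mathcal X^m} W^{(\lambda)}\Big(\hat\mu_n(\omega),\, m^{-1}\sum_{i=1}^m\delta_{z_i}\Big)\,d\mu_\theta^{(m)}(z_1,\dots,z_m).$$ Then for all $n\ge1$, $m\ge 1$ and $\varepsilon>0$ there is a measurable map $\hat\theta_{n,m}:\Omega\to\Theta$ ($\Theta$ carrying its Borel $\sigma$-algebra) such that for every $\omega\in\Omega$: if $\operatorname{argmin}_{\theta\in\Theta}F_{n,m}(\omega,\theta)$ is non-empty, then $\hat\theta_{n,m}(\omega)$ belongs to it; otherwise $\hat\theta_{n,m}(\omega)$ belongs to the $\varepsilon$-argmin $\{\theta\in\Theta : F_{n,m}(\omega,\theta)\le \varepsilon+\inf_{\theta'\in\Theta}F_{n,m}(\omega,\theta')\}$. -/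

import Mathlib

open MeasureTheory Filter Topology

/-- `ρ` is a metric (distance function) on the type `T`. -/
structure IsMetric {T : Type*} (ρ : T → T → ℝ) : Prop where
  eq_zero_iff : ∀ s t, ρ s t = 0 ↔ s = t
  symm : ∀ s t, ρ s t = ρ t s
  triangle : ∀ s t u, ρ s u ≤ ρ s t + ρ t u

/-- The truncated cost `c_λ(x, y) = min {d(x, y), 2λ}`. -/
noncomputable def robustCost {S : Type*} [MetricSpace S] (lam : ℝ) (x y : S) : ℝ :=
  min (dist x y) (2 * lam)

/-- `Π(μ, ν)`: the joint measures on `S × S` with marginals `μ` and `ν`. -/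
def couplings {S : Type*} [MeasurableSpace S] (μ ν : Measure S) : Set (Measure (S × S)) :=
  {π | π.map Prod.fst = μ ∧ π.map Prod.snd = ν}

/-- The robust Wasserstein distance
`W^(λ)(μ, ν) = inf {∫ c_λ(x, y) dπ(x, y) : π ∈ Π(μ, ν)}`
(used for probability measures `μ`, `ν`; the cost is then bounded and measurable, and the set of
couplings contains the product measure). -/
noncomputable def robustWasserstein {S : Type*} [MetricSpace S] [MeasurableSpace S]
    (lam : ℝ) (μ ν : Measure S) : ℝ :=
  sInf ((fun π : Measure (S × S) => ∫ p, robustCost lam p.1 p.2 ∂π) '' couplings μ ν)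

/-- The empirical measure `n⁻¹ ∑ᵢ δ_{xᵢ}` of `n ≥ 1` points. -/
noncomputable def empiricalMeasure {S : Type*} [MeasurableSpace S] {n : ℕ} (x : Fin n → S) :
    Measure S :=
  (n : ENNReal)⁻¹ • ∑ i, Measure.dirac (x i)

/-- `E_m [W^(λ)(ν, μ̂_m)]`, where `μ̂_m` is the empirical measure of `Z_{1:m} ∼ Q`. -/
noncomputable def expectedRobustWasserstein {S : Type*} [MetricSpace S] [MeasurableSpace S]
    (lam : ℝ) (ν : Measure S) {m : ℕ} (Q : Measure (Fin m → S)) : ℝ :=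
  ∫ z, robustWasserstein lam ν (empiricalMeasure z) ∂Q

/-- The set of minimizers of `f`. -/
def argminSet {T : Type*} (f : T → ℝ) : Set T :=
  {t | ∀ s, f t ≤ f s}

/-- `ε`-argmin of `f`: the points `t` with `f t ≤ ε + inf f` (used for `f` bounded below). -/
noncomputable def epsArgminSet {T : Type*} (ε : ℝ) (f : T → ℝ) : Set T :=
  {t | f t ≤ ε + ⨅ s, f s}

/-! The data enter only through a point `x` of `S ^ n`, so it suffices to select on `S ^ n` and
compose with the measurable map `ω ↦ (X₁ ω, …, Xₙ ω)`. Moving the atoms of an empirical measure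
changes the robust distance by at most their sup distance (`exists_coupling_empiricalMeasure_le`).
By symmetry this holds in both arguments. Hence the objective is 1-Lipschitz in `x`, and it is
weakly continuous in the model law because its integrand is bounded and continuous. It is therefore
jointly continuous in `(x, θ)`. For such an objective the argmin is closed and its hitting sets of
compacts are measurable, so its traces on a countable compact cover have measurable selections.
Where no minimizer exists, a point of a dense sequence is used (`exists_measurable_argmin`). -/

/-! ### Measurable selection of minimizers -/

section Selection

/-- Hitting sets of the minimizers of a continuous function over a compact-valued map. -/
theorem measurableSet_hit_argmin {Y T : Type*} [MeasurableSpace Y] [TopologicalSpace T] [T2Space T]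
    {A : Y → Set T} (hc : ∀ y, IsCompact (A y))
    (hA : ∀ C, IsClosed C → MeasurableSet {y | (A y ∩ C).Nonempty})
    {f : T → ℝ} (hf : Continuous f) {C : Set T} (hC : IsClosed C) :
    MeasurableSet {y | ({t | t ∈ A y ∧ ∀ s ∈ A y, f t ≤ f s} ∩ C).Nonempty} := by
  have hcl (q : ℝ) : IsClosed {t | f t ≤ q} := isClosed_le hf continuous_const
  -- A minimizer lies in `C` exactly when `A y ∩ C` reaches every rational level that `A y` reaches.
  -- Compactness makes the minimum over `A y ∩ C` attained.
  have key : {y | ({t | t ∈ A y ∧ ∀ s ∈ A y, f t ≤ f s} ∩ C).Nonempty} =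
      {y | (A y ∩ C).Nonempty} ∩ ⋂ q : ℚ, ({y | (A y ∩ {t | f t ≤ q}).Nonempty}ᶜ ∪
        {y | (A y ∩ (C ∩ {t | f t ≤ q})).Nonempty}) := by
    ext y
    simp only [Set.mem_ofPred_eq, Set.mem_inter_iff, Set.mem_iInter, Set.mem_union, Set.mem_compl_iff]
    constructor
    · rintro ⟨t, ⟨ht, hmin⟩, htC⟩
      refine ⟨⟨t, ht, htC⟩, fun q => or_iff_not_imp_left.2 fun h => ?_⟩
      obtain ⟨s, hs, hsq⟩ := not_not.1 h
      exact ⟨t, ht, htC, (hmin s hs).trans hsq⟩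
    · rintro ⟨hne, h⟩
      obtain ⟨t, ht, hmin⟩ := ((hc y).inter_right hC).exists_isMinOn hne hf.continuousOn
      refine ⟨t, ⟨ht.1, fun s hs => ?_⟩, ht.2⟩
      by_contra! hlt
      obtain ⟨q, hsq, hqt⟩ := exists_rat_btwn hlt
      rcases h q with h | ⟨u, hu, huC, huq⟩
      · exact h ⟨s, hs, hsq.le⟩
      · exact absurd (hmin ⟨hu, huC⟩) (not_le.2 (lt_of_le_of_lt huq hqt))
  rw [key]
  exact (hA C hC).inter (MeasurableSet.iInter fun q =>
    (hA _ (hcl q)).compl.union (hA _ (hC.inter (hcl q))))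

/-- The sets obtained from `A` by successively minimizing `f 0, f 1, …`. -/
def lexArgmin {Y T : Type*} (A : Y → Set T) (f : ℕ → T → ℝ) : ℕ → Y → Set T
  | 0 => A
  | k + 1 => fun y => {t | t ∈ lexArgmin A f k y ∧ ∀ s ∈ lexArgmin A f k y, f k t ≤ f k s}

/-- A compact-valued map with measurable hitting sets has a measurable selection. -/
theorem exists_measurable_selection {Y T : Type*} [MeasurableSpace Y] [MetricSpace T]
    [TopologicalSpace.SeparableSpace T] [MeasurableSpace T] [BorelSpace T] [Nonempty T]
    {A : Y → Set T} (hc : ∀ y, IsCompact (A y))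
    (hA : ∀ C, IsClosed C → MeasurableSet {y | (A y ∩ C).Nonempty}) :
    ∃ s : Y → T, Measurable s ∧ ∀ y, (A y).Nonempty → s y ∈ A y := by
  classical
  -- Distances to a dense sequence separate points, so minimizing all of them in turn leaves at most
  -- one point.
  let f : ℕ → T → ℝ := fun k t => dist t (TopologicalSpace.denseSeq T k)
  have hf (k : ℕ) : Continuous (f k) := continuous_id.dist continuous_const
  let B := lexArgmin A f
  have hBc (k : ℕ) (y : Y) : IsCompact (B k y) := by
    induction k with
    | zero => exact hc y
    | succ k ih =>
      have : B (k + 1) y = B k y ∩ ⋂ s ∈ B k y, {t | f k t ≤ f k s} := by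
        ext t; simp [B, lexArgmin]
      rw [this]
      exact ih.inter_right (isClosed_biInter fun s _ => isClosed_le (hf k) continuous_const)
  have hBm (k : ℕ) : ∀ C, IsClosed C → MeasurableSet {y | (B k y ∩ C).Nonempty} := by
    induction k with
    | zero => exact hA
    | succ k ih => exact fun C hC => measurableSet_hit_argmin (hBc k) ih (hf k) hC
  have hBanti (k : ℕ) (y : Y) : B (k + 1) y ⊆ B k y := fun t ht => ht.1
  have hBne (y : Y) (hy : (A y).Nonempty) (k : ℕ) : (B k y).Nonempty := by
    induction k with
    | zero => exact hy
    | succ k ih =>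
      obtain ⟨t, ht, hmin⟩ := (hBc k y).exists_isMinOn ih (hf k).continuousOn
      exact ⟨t, ht, fun s hs => hmin hs⟩
  -- Cantor's intersection theorem: hitting the limit set reduces to countably many hitting
  -- conditions.
  have hinter (C : Set T) (hC : IsClosed C) (y : Y) :
      ((⋂ k, B k y) ∩ C).Nonempty ↔ ∀ k, (B k y ∩ C).Nonempty := by
    refine ⟨fun ⟨t, ht, htC⟩ k => ⟨t, Set.mem_iInter.1 ht k, htC⟩, fun h => ?_⟩
    have := IsCompact.nonempty_iInter_of_sequence_nonempty_isCompact_isClosed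
      (fun k => B k y ∩ C) (fun k => Set.inter_subset_inter_left _ (hBanti k y)) h
      ((hBc 0 y).inter_right hC) (fun k => (hBc k y).isClosed.inter hC)
    rwa [← Set.iInter_inter] at this
  have hsub (y : Y) : (⋂ k, B k y).Subsingleton := by
    intro t ht u hu
    have heq (k : ℕ) : f k t = f k u :=
      le_antisymm ((Set.mem_iInter.1 ht (k + 1)).2 u (Set.mem_iInter.1 hu k))
        ((Set.mem_iInter.1 hu (k + 1)).2 t (Set.mem_iInter.1 ht k))
    have hcl : IsClosed {s : T | dist t s = dist u s} :=
      isClosed_eq (continuous_const.dist continuous_id) (continuous_const.dist continuous_id)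
    have : (u : T) ∈ {s : T | dist t s = dist u s} :=
      hcl.closure_subset_iff.2 (Set.range_subset_iff.2 heq)
        (TopologicalSpace.denseRange_denseSeq T u)
    simpa using this
  let s : Y → T := fun y => if h : (⋂ k, B k y).Nonempty then h.some else Classical.arbitrary T
  have hs (y : Y) (h : (⋂ k, B k y).Nonempty) : s y ∈ ⋂ k, B k y := by
    simp only [s, dif_pos h]; exact h.some_mem
  have hhit (C : Set T) (hC : IsClosed C) : MeasurableSet {y | ((⋂ k, B k y) ∩ C).Nonempty} := by
    simp only [hinter C hC, Set.ofPred_forall]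
    exact MeasurableSet.iInter fun k => hBm k C hC
  refine ⟨s, measurable_of_isClosed fun C hC => ?_, fun y hy => ?_⟩
  · have : s ⁻¹' C = {y | ((⋂ k, B k y) ∩ C).Nonempty} ∪
        ({y | ((⋂ k, B k y) ∩ Set.univ).Nonempty}ᶜ ∩ {_y | Classical.arbitrary T ∈ C}) := by
      ext y
      simp only [Set.mem_preimage, Set.mem_union, Set.mem_ofPred_eq, Set.mem_inter_iff,
        Set.mem_compl_iff, Set.inter_univ]
      by_cases h : (⋂ k, B k y).Nonempty
      · refine ⟨fun hy => .inl ⟨s y, hs y h, hy⟩, ?_⟩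
        rintro (⟨t, ht, htC⟩ | ⟨h', -⟩)
        · rwa [hsub y (hs y h) ht]
        · exact absurd h h'
      · have : ¬ ((⋂ k, B k y) ∩ C).Nonempty := fun h' => h (h'.mono Set.inter_subset_left)
        simp only [s, dif_neg h, this, h, not_false_eq_true, true_and, false_or]
    rw [this]
    exact (hhit C hC).union ((hhit _ isClosed_univ).compl.inter (MeasurableSet.const _))
  · refine Set.mem_iInter.1 (hs y ?_) 0
    simpa using (hinter Set.univ isClosed_univ y).2 (by simpa using hBne y hy)

/-- A jointly continuous function, bounded below in the second variable, has a measurable map of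
minimizers where they exist and of `ε`-minimizers elsewhere. -/
theorem exists_measurable_argmin {Y T : Type*} [TopologicalSpace Y] [MeasurableSpace Y]
    [OpensMeasurableSpace Y] [MetricSpace T]
    [SigmaCompactSpace T] [MeasurableSpace T] [BorelSpace T] [Nonempty T]
    {G : Y → T → ℝ} (hG : Continuous fun p : Y × T => G p.1 p.2)
    (hbdd : ∀ y, BddBelow (Set.range (G y))) {ε : ℝ} (hε : 0 < ε) :
    ∃ s : Y → T, Measurable s ∧ ∀ y,
      ((argminSet (G y)).Nonempty → s y ∈ argminSet (G y)) ∧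
      (¬ (argminSet (G y)).Nonempty → s y ∈ epsArgminSet ε (G y)) := by
  classical
  have hG1 (t : T) : Continuous fun y => G y t := hG.comp (.prodMk_left t)
  have hG2 (y : Y) : Continuous (G y) := hG.comp (.prodMk_right y)
  have hargcl (y : Y) : IsClosed (argminSet (G y)) := by
    simp only [argminSet, Set.ofPred_forall]
    exact isClosed_iInter fun s => isClosed_le (hG2 y) continuous_const
  have hopen (q : ℝ) : IsOpen {y | ∃ t, G y t < q} := by
    simp only [Set.ofPred_exists]
    exact isOpen_iUnion fun t => isOpen_lt (hG1 t) continuous_const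
  -- Projection along a compact factor is a closed map.
  have hclosed (C : Set T) (hC : IsCompact C) (q : ℝ) : IsClosed {y | ∃ t ∈ C, G y t ≤ q} := by
    have := isCompact_iff_compactSpace.1 hC
    have h1 : IsClosed {p : Y × C | G p.1 p.2 ≤ q} :=
      isClosed_le (hG.comp (continuous_fst.prodMk (continuous_subtype_val.comp continuous_snd)))
        continuous_const
    convert isClosedMap_fst_of_compactSpace _ h1 using 1
    ext y; simp
  have hhit (C : Set T) (hC : IsCompact C) : MeasurableSet {y | (argminSet (G y) ∩ C).Nonempty} := by
    have key : {y | (argminSet (G y) ∩ C).Nonempty} = {_y | C.Nonempty} ∩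
        ⋂ q : ℚ, ({y | ∃ t, G y t < q}ᶜ ∪ {y | ∃ t ∈ C, G y t ≤ q}) := by
      ext y
      simp only [Set.mem_ofPred_eq, Set.mem_inter_iff, Set.mem_iInter, Set.mem_union,
        Set.mem_compl_iff]
      constructor
      · rintro ⟨t, ht, htC⟩
        refine ⟨⟨t, htC⟩, fun q => or_iff_not_imp_left.2 fun h => ?_⟩
        obtain ⟨s, hs⟩ := not_not.1 h
        exact ⟨t, htC, (ht s).trans hs.le⟩
      · rintro ⟨hne, h⟩
        obtain ⟨t, ht, hmin⟩ := hC.exists_isMinOn hne (hG2 y).continuousOn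
        refine ⟨t, fun s => ?_, ht⟩
        by_contra! hlt
        obtain ⟨q, hsq, hqt⟩ := exists_rat_btwn hlt
        rcases h q with h | ⟨u, huC, huq⟩
        · exact h ⟨s, hsq⟩
        · exact absurd (hmin huC) (not_le.2 (lt_of_le_of_lt huq hqt))
    rw [key]
    exact (MeasurableSet.const _).inter (MeasurableSet.iInter fun q =>
      (hopen q).measurableSet.compl.union (hclosed C hC q).measurableSet)
  let K := compactCovering T
  have hK (j : ℕ) : IsCompact (K j) := isCompact_compactCovering T j
  have hsel (j : ℕ) : ∃ s : Y → T, Measurable s ∧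
      ∀ y, (argminSet (G y) ∩ K j).Nonempty → s y ∈ argminSet (G y) ∩ K j := by
    refine exists_measurable_selection (fun y => (hK j).inter_left (hargcl y)) fun C hC => ?_
    simp only [Set.inter_assoc]
    exact hhit _ ((hK j).inter_right hC)
  choose s hsm hs using hsel
  -- The selector uses the first `j` with `p j y`. Quantifying over `t` instead of using the infimum
  -- makes the `ε`-condition an intersection of closed conditions on `y`.
  let p : ℕ → Y → Prop := fun j y => (argminSet (G y) ∩ K j).Nonempty ∨
    (¬ (∃ i, (argminSet (G y) ∩ K i).Nonempty) ∧
      ∀ t, G y (TopologicalSpace.denseSeq T j) ≤ ε + G y t)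
  have hcover (y : Y) (h : (argminSet (G y)).Nonempty) : ∃ i, (argminSet (G y) ∩ K i).Nonempty := by
    obtain ⟨t, ht⟩ := h
    obtain ⟨i, hi⟩ := Set.mem_iUnion.1 (iUnion_compactCovering T ▸ Set.mem_univ t)
    exact ⟨i, t, ht, hi⟩
  have hp (y : Y) : ∃ j, p j y := by
    by_cases h : ∃ i, (argminSet (G y) ∩ K i).Nonempty
    · exact h.imp fun i hi => .inl hi
    · obtain ⟨t, ht⟩ := exists_lt_of_ciInf_lt (lt_add_of_pos_right (⨅ t, G y t) hε)
      obtain ⟨_, hj, j, rfl⟩ := (TopologicalSpace.denseRange_denseSeq T).inter_open_nonempty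
        {u | G y u < (⨅ t, G y t) + ε} (isOpen_lt (hG2 y) continuous_const) ⟨t, ht⟩
      refine ⟨j, .inr ⟨h, fun u => ?_⟩⟩
      have := ciInf_le (hbdd y) u
      have : G y (TopologicalSpace.denseSeq T j) < (⨅ t, G y t) + ε := hj
      linarith
  have hpm (j : ℕ) : MeasurableSet {y | p j y} := by
    refine (hhit _ (hK j)).union (MeasurableSet.inter (MeasurableSet.compl ?_) ?_)
    · change MeasurableSet {y | ∃ i, (argminSet (G y) ∩ K i).Nonempty}
      simp only [Set.ofPred_exists]
      exact MeasurableSet.iUnion fun i => hhit _ (hK i)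
    · change MeasurableSet {y | ∀ t, G y (TopologicalSpace.denseSeq T j) ≤ ε + G y t}
      simp only [Set.ofPred_forall]
      exact (isClosed_iInter fun t =>
        isClosed_le (hG1 _) (continuous_const.add (hG1 t))).measurableSet
  let g : ℕ → Y → T := fun j =>
    {y | (argminSet (G y) ∩ K j).Nonempty}.piecewise (s j)
      fun _ => TopologicalSpace.denseSeq T j
  have hg (j : ℕ) : Measurable (g j) := (hsm j).piecewise (hhit _ (hK j)) measurable_const
  refine ⟨fun y => g (Nat.find (hp y)) y, Measurable.find hg hpm hp, fun y => ?_⟩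
  change (_ → g (Nat.find (hp y)) y ∈ _) ∧ (_ → g (Nat.find (hp y)) y ∈ _)
  set j := Nat.find (hp y)
  have hjp : p j y := Nat.find_spec (hp y)
  constructor
  · intro h
    rcases hjp with h' | ⟨h', -⟩
    · rw [show g j y = s j y from Set.piecewise_eq_of_mem _ _ _ h']
      exact (hs j y h').1
    · exact absurd (hcover y h) h'
  · intro h
    rcases hjp with ⟨t, ht, -⟩ | ⟨h', hle⟩
    · exact absurd ⟨t, ht⟩ h
    · rw [show g j y = TopologicalSpace.denseSeq T j from
        Set.piecewise_eq_of_notMem _ _ _ fun h'' => h' ⟨j, h''⟩]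
      have : G y (TopologicalSpace.denseSeq T j) - ε ≤ ⨅ t, G y t :=
        le_ciInf fun t => by linarith [hle t]
      change G y (TopologicalSpace.denseSeq T j) ≤ ε + ⨅ t, G y t
      linarith

end Selection

/-! ### The truncated cost -/

section RobustCost

variable {S : Type*} [MetricSpace S] {lam : ℝ}

theorem robustCost_nonneg (hlam : 0 ≤ lam) (x y : S) : 0 ≤ robustCost lam x y :=
  le_min dist_nonneg (mul_nonneg zero_le_two hlam)

theorem robustCost_comm (x y : S) : robustCost lam x y = robustCost lam y x := by
  rw [robustCost, robustCost, dist_comm]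

theorem robustCost_le_add (x y z : S) :
    robustCost lam x z ≤ robustCost lam y z + dist y x := by
  have h1 := dist_triangle_left x z y
  have h2 : 0 ≤ dist y x := dist_nonneg
  unfold robustCost
  rcases min_cases (dist y z) (2 * lam) with h | h <;>
    rcases min_cases (dist x z) (2 * lam) with h' | h' <;> linarith

theorem continuous_robustCost : Continuous fun p : S × S => robustCost lam p.1 p.2 :=
  continuous_dist.min continuous_const

variable [MeasurableSpace S]

theorem bddBelow_integral_couplings (hlam : 0 ≤ lam) (μ ν : Measure S) :
    BddBelow ((fun π : Measure (S × S) => ∫ p, robustCost lam p.1 p.2 ∂π) '' couplings μ ν) :=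
  ⟨0, by rintro _ ⟨π, -, rfl⟩; exact integral_nonneg fun p => robustCost_nonneg hlam _ _⟩

theorem robustWasserstein_nonneg (hlam : 0 ≤ lam) (μ ν : Measure S) :
    0 ≤ robustWasserstein lam μ ν :=
  Real.sInf_nonneg (by
    rintro _ ⟨π, -, rfl⟩; exact integral_nonneg fun p => robustCost_nonneg hlam _ _)

variable [BorelSpace S]

theorem integrable_robustCost [SecondCountableTopology S] (hlam : 0 ≤ lam) (π : Measure (S × S))
    [IsFiniteMeasure π] : Integrable (fun p => robustCost lam p.1 p.2) π := by
  refine Integrable.of_bound continuous_robustCost.measurable.aestronglyMeasurable (2 * lam)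
    (ae_of_all _ fun p => ?_)
  rw [Real.norm_of_nonneg (robustCost_nonneg hlam _ _)]
  exact min_le_right _ _

end RobustCost

/-! ### Couplings and empirical measures -/

section Couplings

variable {S : Type*} [MeasurableSpace S]

theorem isProbabilityMeasure_of_mem_couplings {μ ν : Measure S} [IsProbabilityMeasure μ]
    {π : Measure (S × S)} (h : π ∈ couplings μ ν) : IsProbabilityMeasure π := by
  have : IsProbabilityMeasure (π.map Prod.fst) := by rw [h.1]; infer_instance
  exact Measure.isProbabilityMeasure_of_map Prod.fst

theorem prod_mem_couplings (μ ν : Measure S) [IsProbabilityMeasure μ] [IsProbabilityMeasure ν] :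
    μ.prod ν ∈ couplings μ ν := by
  constructor <;> simp

theorem map_swap_mem_couplings {μ ν : Measure S} {π : Measure (S × S)} (h : π ∈ couplings μ ν) :
    π.map Prod.swap ∈ couplings ν μ := by
  constructor
  · rw [Measure.map_map measurable_fst measurable_swap]; exact h.2
  · rw [Measure.map_map measurable_snd measurable_swap]; exact h.1

theorem isProbabilityMeasure_empiricalMeasure {n : ℕ} (hn : 1 ≤ n) (x : Fin n → S) :
    IsProbabilityMeasure (empiricalMeasure x) := by
  constructor
  have : (n : ENNReal) ≠ 0 := by exact_mod_cast (by omega : n ≠ 0)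
  simp [empiricalMeasure, ENNReal.inv_mul_cancel this]

open Classical in
/-- A measure on a product whose first marginal lives on `{x₁, …, xₙ}` is split according to the
index of the first coordinate. -/
theorem sum_smul_restrict_fst_eq [MeasurableSingletonClass S] {n : ℕ} (x : Fin n → S)
    {π : Measure (S × S)} (h : ∀ᵐ p ∂π, p.1 ∈ Finset.univ.image x) :
    ∑ i, ((Finset.univ.filter fun j => x j = x i).card : ENNReal)⁻¹ •
      π.restrict (Prod.fst ⁻¹' {x i}) = π := by
  -- Grouped by value, each fibre occurs once per index carrying that value, which cancels its
  -- weight.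
  rw [Finset.sum_comp (fun s : S => ((Finset.univ.filter fun j => x j = s).card : ENNReal)⁻¹ •
      π.restrict (Prod.fst ⁻¹' {s})) x]
  have h1 : ∀ s ∈ Finset.univ.image x, (Finset.univ.filter fun j => x j = s).card •
      (((Finset.univ.filter fun j => x j = s).card : ENNReal)⁻¹ • π.restrict (Prod.fst ⁻¹' {s})) =
      π.restrict (Prod.fst ⁻¹' {s}) := by
    intro s hs
    obtain ⟨i, -, rfl⟩ := Finset.mem_image.1 hs
    have h0 : ((Finset.univ.filter fun j => x j = x i).card : ENNReal) ≠ 0 := by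
      exact_mod_cast (Finset.card_pos.2 ⟨i, by simp⟩).ne'
    rw [← Nat.cast_smul_eq_nsmul ENNReal, smul_smul,
      ENNReal.mul_inv_cancel h0 (ENNReal.natCast_ne_top _), one_smul]
  rw [Finset.sum_congr rfl h1, Finset.sum_coe_sort (Finset.univ.image x)
    (fun s => π.restrict (Prod.fst ⁻¹' {s})) |>.symm, ← Measure.sum_fintype,
    ← Measure.restrict_biUnion_finset (s := fun s : S => Prod.fst ⁻¹' {s})]
  · refine Measure.restrict_eq_self_of_ae_mem ?_
    filter_upwards [h] with p hp
    simpa [eq_comm] using hp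
  · intro s _ t _ hst
    exact Set.disjoint_left.2 fun p hp hp' => hst (hp.symm.trans hp')
  · exact fun s => measurable_fst (measurableSet_singleton s)

end Couplings

/-! ### Continuity of the robust distance and of its expectation -/

section Wasserstein

variable {S : Type*} [MetricSpace S] [SecondCountableTopology S] [MeasurableSpace S] [BorelSpace S]
  {lam : ℝ}

/-- Moving the atoms of an empirical measure moves couplings along. -/
theorem exists_coupling_empiricalMeasure_le (hlam : 0 ≤ lam) {n : ℕ} (hn : 1 ≤ n) (x x' : Fin n → S)
    {ν : Measure S} {π : Measure (S × S)} (hπ : π ∈ couplings (empiricalMeasure x) ν) :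
    ∃ π' ∈ couplings (empiricalMeasure x') ν,
      ∫ p, robustCost lam p.1 p.2 ∂π' ≤ ∫ p, robustCost lam p.1 p.2 ∂π + dist x x' := by
  classical
  have := isProbabilityMeasure_empiricalMeasure hn x
  have hπp := isProbabilityMeasure_of_mem_couplings hπ
  -- Atoms may coincide: `N i` indices share the value `x i`, and each takes the fraction `1 / N i`
  -- of the fibre, hence mass `1 / n`.
  let N : Fin n → ℕ := fun i => (Finset.univ.filter fun j => x j = x i).card
  have hN (i : Fin n) : (N i : ENNReal) ≠ 0 := by
    exact_mod_cast (Finset.card_pos.2 ⟨i, by simp⟩).ne'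
  let ρ : Fin n → Measure (S × S) := fun i => π.restrict (Prod.fst ⁻¹' {x i})
  have hmeas (i : Fin n) : Measurable fun p : S × S => (x' i, p.2) :=
    measurable_const.prodMk measurable_snd
  have hatom (i : Fin n) : π (Prod.fst ⁻¹' {x i}) = (n : ENNReal)⁻¹ * N i := by
    rw [← Measure.map_apply measurable_fst (measurableSet_singleton _), hπ.1]
    simp [empiricalMeasure, N, Set.indicator_apply, Finset.sum_boole]
  have hae : ∀ᵐ p ∂π, p.1 ∈ Finset.univ.image x := by
    have : ∀ᵐ s ∂(π.map Prod.fst), s ∈ Finset.univ.image x := by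
      rw [hπ.1, empiricalMeasure]
      refine Measure.ae_smul_measure ?_ _
      rw [← Measure.sum_fintype]
      refine Measure.ae_sum_iff.2 fun i => ?_
      rw [ae_dirac_eq]
      exact Finset.mem_image_of_mem x (Finset.mem_univ i)
    exact ae_of_ae_map measurable_fst.aemeasurable this
  have hsum : ∑ i, (N i : ENNReal)⁻¹ • ρ i = π := sum_smul_restrict_fst_eq x hae
  have hfin (i : Fin n) : IsFiniteMeasure ((N i : ENNReal)⁻¹ • ρ i) :=
    (ρ i).smul_finite (ENNReal.inv_ne_top.2 (hN i))
  -- The share of index `i` has its first coordinate moved to `x' i`; the second is kept.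
  refine ⟨∑ i, ((N i : ENNReal)⁻¹ • ρ i).map fun p => (x' i, p.2), ⟨?_, ?_⟩, ?_⟩
  · rw [Measure.map_finset_sum measurable_fst.aemeasurable, empiricalMeasure, Finset.smul_sum]
    refine Finset.sum_congr rfl fun i _ => ?_
    rw [Measure.map_map measurable_fst (hmeas i)]
    change Measure.map (fun _ => x' i) _ = _
    rw [Measure.map_const, Measure.smul_apply, Measure.restrict_apply_univ, hatom, smul_eq_mul,
      mul_left_comm, ENNReal.inv_mul_cancel (hN i) (ENNReal.natCast_ne_top _), mul_one]
  · rw [Measure.map_finset_sum measurable_snd.aemeasurable]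
    conv_rhs => rw [← hπ.2, ← hsum, Measure.map_finset_sum measurable_snd.aemeasurable]
    refine Finset.sum_congr rfl fun i _ => ?_
    rw [Measure.map_map measurable_snd (hmeas i)]
    rfl
  · have hint (i : Fin n) : Integrable (fun p : S × S => robustCost lam p.1 p.2 + dist x x')
        ((N i : ENNReal)⁻¹ • ρ i) := (integrable_robustCost hlam _).add (integrable_const _)
    calc ∫ p, robustCost lam p.1 p.2 ∂(∑ i, ((N i : ENNReal)⁻¹ • ρ i).map fun p => (x' i, p.2))
        = ∑ i, ∫ p, robustCost lam (x' i) p.2 ∂((N i : ENNReal)⁻¹ • ρ i) := by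
          rw [integral_finsetSum_measure fun i _ => integrable_robustCost hlam _]
          refine Finset.sum_congr rfl fun i _ => ?_
          rw [integral_map (hmeas i).aemeasurable
            continuous_robustCost.measurable.aestronglyMeasurable]
      _ ≤ ∑ i, ∫ p, (robustCost lam p.1 p.2 + dist x x') ∂((N i : ENNReal)⁻¹ • ρ i) := by
          refine Finset.sum_le_sum fun i _ => integral_mono_ae ?_ (hint i) ?_
          · exact (integrable_map_measure
              continuous_robustCost.measurable.aestronglyMeasurable (hmeas i).aemeasurable).1
              (integrable_robustCost hlam _)
          · refine Measure.ae_smul_measure ?_ _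
            filter_upwards [ae_restrict_mem (measurable_fst (measurableSet_singleton (x i)))]
              with p hp
            have hp' : p.1 = x i := hp
            rw [hp']
            exact (robustCost_le_add _ (x i) _).trans
              (add_le_add_right (dist_le_pi_dist x x' i) _)
      _ = ∫ p, (robustCost lam p.1 p.2 + dist x x') ∂π := by
          conv_rhs => rw [← hsum]
          rw [integral_finsetSum_measure fun i _ => hint i]
      _ = ∫ p, robustCost lam p.1 p.2 ∂π + dist x x' := by
          rw [integral_add (integrable_robustCost hlam _) (integrable_const _)]
          simp

theorem robustWasserstein_le (hlam : 0 ≤ lam) (μ ν : Measure S) [IsProbabilityMeasure μ]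
    [IsProbabilityMeasure ν] : robustWasserstein lam μ ν ≤ 2 * lam := by
  refine (csInf_le (bddBelow_integral_couplings hlam μ ν)
    ⟨μ.prod ν, prod_mem_couplings μ ν, rfl⟩).trans ?_
  refine (integral_mono (integrable_robustCost hlam _) (integrable_const (2 * lam))
    fun p => min_le_right _ _).trans ?_
  simp

theorem robustWasserstein_comm (μ ν : Measure S) :
    robustWasserstein lam μ ν = robustWasserstein lam ν μ := by
  have h (μ ν : Measure S) :
      (fun π : Measure (S × S) => ∫ p, robustCost lam p.1 p.2 ∂π) '' couplings μ ν ⊆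
        (fun π : Measure (S × S) => ∫ p, robustCost lam p.1 p.2 ∂π) '' couplings ν μ := by
    rintro _ ⟨π, hπ, rfl⟩
    refine ⟨π.map Prod.swap, map_swap_mem_couplings hπ, ?_⟩
    change ∫ p, robustCost lam p.1 p.2 ∂(π.map Prod.swap) = _
    rw [integral_map measurable_swap.aemeasurable
      continuous_robustCost.measurable.aestronglyMeasurable]
    exact integral_congr_ae (ae_of_all _ fun p => robustCost_comm _ _)
  exact congrArg sInf ((h μ ν).antisymm (h ν μ))

theorem robustWasserstein_empiricalMeasure_le (hlam : 0 ≤ lam) {n : ℕ} (hn : 1 ≤ n)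
    (x x' : Fin n → S) (ν : Measure S) [IsProbabilityMeasure ν] :
    robustWasserstein lam (empiricalMeasure x') ν ≤
      robustWasserstein lam (empiricalMeasure x) ν + dist x x' := by
  have := isProbabilityMeasure_empiricalMeasure hn x
  rw [← sub_le_iff_le_add]
  refine le_csInf ⟨_, _, prod_mem_couplings _ ν, rfl⟩ ?_
  rintro _ ⟨π, hπ, rfl⟩
  obtain ⟨π', hπ', hle⟩ := exists_coupling_empiricalMeasure_le hlam hn x x' hπ
  rw [sub_le_iff_le_add]
  exact (csInf_le (bddBelow_integral_couplings hlam _ _) ⟨π', hπ', rfl⟩).trans hle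

theorem lipschitzWith_robustWasserstein_empiricalMeasure (hlam : 0 ≤ lam) {n : ℕ} (hn : 1 ≤ n)
    (ν : Measure S) [IsProbabilityMeasure ν] :
    LipschitzWith 1 fun x : Fin n → S => robustWasserstein lam (empiricalMeasure x) ν :=
  LipschitzWith.of_le_add fun x x' => by
    rw [dist_comm]; exact robustWasserstein_empiricalMeasure_le hlam hn x' x ν

/-- Symmetry turns the Lipschitz bound in the first argument into one in the second. -/
theorem continuous_robustWasserstein_empiricalMeasure (hlam : 0 ≤ lam) {m : ℕ} (hm : 1 ≤ m)
    (μ : Measure S) [IsProbabilityMeasure μ] :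
    Continuous fun z : Fin m → S => robustWasserstein lam μ (empiricalMeasure z) := by
  simp only [robustWasserstein_comm μ]
  exact (lipschitzWith_robustWasserstein_empiricalMeasure hlam hm μ).continuous

theorem norm_robustWasserstein_le (hlam : 0 ≤ lam) (μ ν : Measure S) [IsProbabilityMeasure μ]
    [IsProbabilityMeasure ν] : ‖robustWasserstein lam μ ν‖ ≤ 2 * lam := by
  rw [Real.norm_of_nonneg (robustWasserstein_nonneg hlam μ ν)]
  exact robustWasserstein_le hlam μ ν

theorem integrable_robustWasserstein_empiricalMeasure (hlam : 0 ≤ lam) {m : ℕ} (hm : 1 ≤ m)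
    (μ : Measure S) [IsProbabilityMeasure μ] (Q : Measure (Fin m → S)) [IsFiniteMeasure Q] :
    Integrable (fun z => robustWasserstein lam μ (empiricalMeasure z)) Q :=
  Integrable.of_bound
    (continuous_robustWasserstein_empiricalMeasure hlam hm μ).measurable.aestronglyMeasurable
    (2 * lam) (ae_of_all _ fun z =>
      have := isProbabilityMeasure_empiricalMeasure hm z
      norm_robustWasserstein_le hlam μ _)

theorem lipschitzWith_expectedRobustWasserstein (hlam : 0 ≤ lam) {n m : ℕ} (hn : 1 ≤ n)
    (hm : 1 ≤ m) (Q : Measure (Fin m → S)) [IsProbabilityMeasure Q] :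
    LipschitzWith 1 fun x : Fin n → S => expectedRobustWasserstein lam (empiricalMeasure x) Q := by
  refine LipschitzWith.of_le_add fun x x' => ?_
  have := isProbabilityMeasure_empiricalMeasure hn x
  have := isProbabilityMeasure_empiricalMeasure hn x'
  have hint := integrable_robustWasserstein_empiricalMeasure hlam hm (empiricalMeasure x') Q
  calc expectedRobustWasserstein lam (empiricalMeasure x) Q
      ≤ ∫ z, (robustWasserstein lam (empiricalMeasure x') (empiricalMeasure z) + dist x x') ∂Q := by
        refine integral_mono (integrable_robustWasserstein_empiricalMeasure hlam hm _ Q)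
          (hint.add (integrable_const _)) fun z => ?_
        have := isProbabilityMeasure_empiricalMeasure hm z
        rw [dist_comm]
        exact robustWasserstein_empiricalMeasure_le hlam hn x' x _
    _ = expectedRobustWasserstein lam (empiricalMeasure x') Q + dist x x' := by
        rw [integral_add hint (integrable_const _)]
        simp [expectedRobustWasserstein]

theorem continuous_expectedRobustWasserstein (hlam : 0 ≤ lam) {m : ℕ} (hm : 1 ≤ m)
    (μ : Measure S) [IsProbabilityMeasure μ] :
    Continuous fun Q : ProbabilityMeasure (Fin m → S) =>
      expectedRobustWasserstein lam μ (Q : Measure (Fin m → S)) := by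
  let g : BoundedContinuousFunction (Fin m → S) ℝ := .ofNormedAddCommGroup _
    (continuous_robustWasserstein_empiricalMeasure hlam hm μ) (2 * lam) fun z =>
      have := isProbabilityMeasure_empiricalMeasure hm z
      norm_robustWasserstein_le hlam μ _
  exact continuous_iff_continuousAt.2 fun Q =>
    ProbabilityMeasure.tendsto_iff_forall_integral_tendsto.1 tendsto_id g

end Wasserstein

theorem theorem9
    {Ω S : Type*} [MeasurableSpace Ω]
    -- the sample space: a metric space with Polish topology and its Borel σ-algebra
    [MetricSpace S] [PolishSpace S] [MeasurableSpace S] [BorelSpace S]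
    (lam : ℝ) (hlam : 0 ≤ lam)
    -- the parameter space, with its distance
    {d : ℕ} (Θ : Set (EuclideanSpace ℝ (Fin d)))
    (hΘne : Θ.Nonempty) (hΘσ : IsSigmaCompact Θ) (hΘmeas : MeasurableSet Θ)
    (ρ : Θ → Θ → ℝ) (hρ : IsMetric ρ)
    (hρtop : ∀ (t : ℕ → Θ) (t₀ : Θ),
      Tendsto t atTop (𝓝 t₀) → Tendsto (fun k => ρ (t k) t₀) atTop (𝓝 0))
    -- the model: for each sample size `m` and each `θ`, a law on `S ^ m`
    (model : (m : ℕ) → Θ → ProbabilityMeasure (Fin m → S))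
    (hmodel : ∀ m : ℕ, 1 ≤ m → ∀ (t : ℕ → Θ) (t₀ : Θ),
      Tendsto (fun k => ρ (t k) t₀) atTop (𝓝 0) →
        Tendsto (fun k => model m (t k)) atTop (𝓝 (model m t₀)))
    (n m : ℕ) (hn : 1 ≤ n) (hm : 1 ≤ m)
    -- the data `X₁, …, Xₙ`
    (X : Fin n → Ω → S) (hX : ∀ i, Measurable (X i))
    (ε : ℝ) (hε : 0 < ε) :
    ∃ est : Ω → Θ, Measurable est ∧
      ∀ ω : Ω,
        ((argminSet fun θ : Θ => expectedRobustWasserstein lam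
            (empiricalMeasure fun i => X i ω) (model m θ : Measure (Fin m → S))).Nonempty →
          est ω ∈ argminSet fun θ : Θ => expectedRobustWasserstein lam
            (empiricalMeasure fun i => X i ω) (model m θ : Measure (Fin m → S))) ∧
        (¬ (argminSet fun θ : Θ => expectedRobustWasserstein lam
            (empiricalMeasure fun i => X i ω) (model m θ : Measure (Fin m → S))).Nonempty →
          est ω ∈ epsArgminSet ε fun θ : Θ => expectedRobustWasserstein lam
            (empiricalMeasure fun i => X i ω) (model m θ : Measure (Fin m → S))) := by
  have := isSigmaCompact_iff_sigmaCompactSpace.1 hΘσ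
  have := hΘne.to_subtype
  have hcont : Continuous (model m) :=
    continuous_iff_seqContinuous.2 fun {t t₀} h => hmodel m hm t t₀ (hρtop t t₀ h)
  have hG : Continuous fun p : (Fin n → S) × Θ => expectedRobustWasserstein lam
      (empiricalMeasure p.1) (model m p.2 : Measure (Fin m → S)) := by
    -- Continuity in `θ`, with a Lipschitz constant in `x` uniform in `θ`, gives joint continuity.
    refine continuous_prod_of_continuous_lipschitzWith _ 1 (fun x => ?_) fun θ =>
      lipschitzWith_expectedRobustWasserstein hlam hn hm (model m θ : Measure (Fin m → S))
    have := isProbabilityMeasure_empiricalMeasure hn x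
    exact (continuous_expectedRobustWasserstein hlam hm (empiricalMeasure x)).comp hcont
  obtain ⟨s, hs, hmin⟩ := exists_measurable_argmin (G := fun (x : Fin n → S) (θ : Θ) =>
    expectedRobustWasserstein lam (empiricalMeasure x) (model m θ : Measure (Fin m → S)))
    hG (fun x => ⟨0, by
    rintro _ ⟨θ, rfl⟩
    exact integral_nonneg fun z => robustWasserstein_nonneg hlam _ _⟩) hε
  exact ⟨fun ω => s fun i => X i ω, hs.comp (measurable_pi_lambda _ hX),
    fun ω => hmin fun i => X i ω⟩
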